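/- Let $\mathcal H$ be a finite-dimensional complex Hilbert space (inner product linear in the second argument), and let $\{p_i,\rho_i\}_{i=1}^m$ be an ensemble of linearly independent states of ranks $r_1,\dots,r_m$ on $\mathcal H$: $p_i>0$, $\sum_i p_i=1$, $\rho_i\ge 0$, $\operatorname{Tr}\rho_i=1$, $\operatorname{rank}\rho_i=r_i$, and the supports $\operatorname{supp}\rho_i$ are linearly independent subspaces which together span $\mathcal H$ (so $\sum_i r_i=\dim\mathcal H$). Let $\{\Pi_i\}_{i=1}^m$ be an optimal POVM for its minimum error discrimination, i.e. a POVM ($\Pi_i\ge0$, $\sum_i\Pi_i=\mathbb 1$) that maximizes $\sum_i p_i\operatorname{Tr}(\rho_i\Pi_i)$ over all $m$-element POVMs. Let $\psi_{ij}\in\mathcal H$ ($1\le i\le m$, $1\le j\le r_i$) be any vectors with $p_i\rho_i=\sum_{j=1}^{r_i}|\psi_{ij}\rangle\langle\psi_{ij}|$ for all $i$. Let $G$ be their Gram matrix, $G^{(l\,i)}_{k\,j}=\langle\psi_{lk},\psi_{ij}\rangle$, with positive square root $G^{1/2}$, and let $u_{ij}=\sum_{l,k}(G^{-1})^{(l\,i)}_{k\,j}\,\psi_{lk}$.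 For an $n\times n$ matrix $W$ ($n=\sum_i r_i$), partitioned into blocks of sizes $r_1,\dots,r_m$, let $w_{ij}=\sum_{l,k}(G^{1/2}W)^{(l\,i)}_{k\,j}\,u_{lk}$ and let $X^{(ii)}$ be the $i$-th diagonal block ($r_i\times r_i$) of $G^{1/2}W$. Call $W$ adapted if it is unitary, $\Pi_i=\sum_{j=1}^{r_i}|w_{ij}\rangle\langle w_{ij}|$ for all $i$, and $X^{(ii)}\ge0$ for all $i$. Then there is exactly one adapted $W$, and for it $X^{(ii)}>0$ for all $i$. Moreover, put $$\chi_{ij}=\sum_{k=1}^{r_i}X^{(ii)}_{kj}\,\psi_{ik},\qquad \sigma_i=\frac{\sum_{j}|\chi_{ij}\rangle\langle\chi_{ij}|}{\sum_{j}\|\chi_{ij}\|^2},\qquad q_i=\frac{\sum_{j}\|\chi_{ij}\|^2}{\sum_{l,k}\|\chi_{lk}\|^2}.$$ Then $\widetilde Q=\{q_i,\sigma_i\}_{i=1}^m$ is again an ensemble of linearly independent states of ranks $r_1,\dots,r_m$ on $\mathcal H$ (in the sense above), $\operatorname{supp}(q_i\sigma_i)=\operatorname{supp}(p_i\rho_i)$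 for all $i$, and $\{\Pi_i\}$ is the pretty good measurement of $\widetilde Q$: $$\Pi_i=\Big(\sum_{j}q_j\sigma_j\Big)^{-1/2}q_i\sigma_i\Big(\sum_{k}q_k\sigma_k\Big)^{-1/2},\qquad 1\le i\le m.$$ -/

import Mathlib

open scoped ComplexOrder MatrixOrder

noncomputable section

namespace MED

section Ensembles

variable {H : Type*} [NormedAddCommGroup H] [InnerProductSpace ℂ H]

/-- The (unnormalised) pure state `|v⟩⟨v|`. -/
def ketbra (v : H) : H →L[ℂ] H := InnerProductSpace.rankOne ℂ v v

/-- The support of a self-adjoint operator on a finite-dimensional space: its range, which is the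
orthogonal complement of its kernel. -/
def supp (A : H →L[ℂ] H) : Submodule ℂ H := LinearMap.range (A : H →ₗ[ℂ] H)

/-- The trace of an operator. -/
def tr (A : H →L[ℂ] H) : ℂ := LinearMap.trace ℂ H (A : H →ₗ[ℂ] H)

/-- `{p i, ρ i}` is an ensemble of linearly independent states of ranks `r i` on `H`: the `ρ i` are
density operators, the `p i` positive probabilities, and the supports of the `ρ i` are linearly
independent subspaces that together span `H`. -/
structure IsLIEnsemble {m : ℕ} (r : Fin m → ℕ) (p : Fin m → ℝ) (ρ : Fin m → H →L[ℂ] H) : Prop where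
  prob_pos : ∀ i, 0 < p i
  prob_sum : ∑ i, p i = 1
  pos : ∀ i, (ρ i).IsPositive
  trace_one : ∀ i, tr (ρ i) = 1
  rank_eq : ∀ i, Module.finrank ℂ (supp (ρ i)) = r i
  indep : iSupIndep fun i => supp (ρ i)
  span : ⨆ i, supp (ρ i) = ⊤

/-- An `m`-element POVM. -/
structure IsPOVM {m : ℕ} (E : Fin m → H →L[ℂ] H) : Prop where
  pos : ∀ i, (E i).IsPositive
  sum_eq : ∑ i, E i = 1

/-- The average probability of success `∑ i, p i Tr (ρ i E i)`; each trace is a real number when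
`ρ i` and `E i` are positive. -/
def successProb {m : ℕ} (p : Fin m → ℝ) (ρ E : Fin m → H →L[ℂ] H) : ℝ :=
  ∑ i, p i * (tr (ρ i * E i)).re

/-- `E` is an optimal POVM for the minimum error discrimination of `{p i, ρ i}`. -/
def IsOptimalPOVM {m : ℕ} (p : Fin m → ℝ) (ρ E : Fin m → H →L[ℂ] H) : Prop :=
  IsPOVM E ∧ ∀ F : Fin m → H →L[ℂ] H, IsPOVM F → successProb p ρ F ≤ successProb p ρ E

/-- The pretty good measurement `S ^ (-1/2) (q i σ i) S ^ (-1/2)`, where `S = ∑ j, q j σ j`. -/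
def pgm [CompleteSpace H] {m : ℕ} (q : Fin m → ℝ) (σ : Fin m → H →L[ℂ] H) (i : Fin m) :
    H →L[ℂ] H :=
  (∑ j, (q j : ℂ) • σ j) ^ (-1 / 2 : ℝ) * ((q i : ℂ) • σ i) *
    (∑ j, (q j : ℂ) • σ j) ^ (-1 / 2 : ℝ)

end Ensembles

section Construction

variable {H : Type*} [NormedAddCommGroup H] [InnerProductSpace ℂ H] {m : ℕ} {r : Fin m → ℕ}

/-- Two-tier indices: the block index `i` and the index `j` inside the block of size `r i`. -/
abbrev Idx {m : ℕ} (r : Fin m → ℕ) : Type := Σ i : Fin m, Fin (r i)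

/-- The vectors `ψ` decompose the unnormalised states: `p i ρ i = ∑ j, |ψ i j⟩⟨ψ i j|`. -/
def IsDecomposition (p : Fin m → ℝ) (ρ : Fin m → H →L[ℂ] H) (ψ : Idx r → H) : Prop :=
  ∀ i, (p i : ℂ) • ρ i = ∑ j : Fin (r i), ketbra (ψ ⟨i, j⟩)

/-- The Gram matrix `G` of the vectors `ψ`. -/
def G (ψ : Idx r → H) : Matrix (Idx r) (Idx r) ℂ := Matrix.gram ℂ ψ

/-- The system `u` biorthogonal to `ψ`: `u b = ∑ a, (G⁻¹) a b • ψ a`. -/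
def dualVec (ψ : Idx r → H) (b : Idx r) : H := ∑ a, (G ψ)⁻¹ a b • ψ a

/-- The matrix `G ^ (1/2) W`, with the positive square root of `G`. -/
def rootMul (ψ : Idx r → H) (W : Matrix (Idx r) (Idx r) ℂ) : Matrix (Idx r) (Idx r) ℂ :=
  CFC.sqrt (G ψ) * W

/-- The vectors `w b = ∑ a, (G ^ (1/2) W) a b • u a`. -/
def measVec (ψ : Idx r → H) (W : Matrix (Idx r) (Idx r) ℂ) (b : Idx r) : H :=
  ∑ a, rootMul ψ W a b • dualVec ψ a

/-- The `i`-th diagonal block of `G ^ (1/2) W`. -/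
def X (ψ : Idx r → H) (W : Matrix (Idx r) (Idx r) ℂ) (i : Fin m) :
    Matrix (Fin (r i)) (Fin (r i)) ℂ :=
  Matrix.blockDiag' (rootMul ψ W) i

/-- `W` is a unitary matrix which represents the measurement `E`, that is
`E i = ∑ j, |w i j⟩⟨w i j|`, and for which the diagonal blocks of `G ^ (1/2) W` are positive
semidefinite. -/
structure IsAdapted (ψ : Idx r → H) (E : Fin m → H →L[ℂ] H) (W : Matrix (Idx r) (Idx r) ℂ) :
    Prop where
  unitary : W ∈ Matrix.unitaryGroup (Idx r) ℂ
  resolves : ∀ i, E i = ∑ j : Fin (r i), ketbra (measVec ψ W ⟨i, j⟩)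
  posSemidef : ∀ i, (X ψ W i).PosSemidef

/-- The vectors `χ i j = ∑ k, (X i) k j • ψ i k`. -/
def chi (ψ : Idx r → H) (W : Matrix (Idx r) (Idx r) ℂ) (i : Fin m) (j : Fin (r i)) : H :=
  ∑ k : Fin (r i), X ψ W i k j • ψ ⟨i, k⟩

/-- The weight `∑ j, ⟨χ i j, χ i j⟩`. -/
def weight (ψ : Idx r → H) (W : Matrix (Idx r) (Idx r) ℂ) (i : Fin m) : ℝ :=
  ∑ j : Fin (r i), ‖chi ψ W i j‖ ^ 2

/-- The states `σ i` of the associated ensemble. -/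
def sigma (ψ : Idx r → H) (W : Matrix (Idx r) (Idx r) ℂ) (i : Fin m) : H →L[ℂ] H :=
  ((weight ψ W i : ℂ))⁻¹ • ∑ j : Fin (r i), ketbra (chi ψ W i j)

/-- The probabilities `q i` of the associated ensemble. -/
def q (ψ : Idx r → H) (W : Matrix (Idx r) (Idx r) ℂ) (i : Fin m) : ℝ :=
  weight ψ W i / ∑ l, weight ψ W l

end Construction

end MED

end

namespace MED

/-! ### Sums of rank-one operators, traces and square roots. -/

section Operators

variable {H : Type*} [NormedAddCommGroup H] [InnerProductSpace ℂ H]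

/-! Put `R i = p i ρ i`, and let `Z` be the Hermitian part of `∑ i, R i * E i`. Optimality of `E`
gives `Z - R i ≥ 0` and `(Z - R i) * E i = 0` (`lagrange_optimality`). Since `Z ≥ R i` for all `i`
and the supports span, `Z` is positive and invertible.

The matrix `G^(1/2) W` has entries `⟨ψ c, w b⟩` (`inner_measVec`), and `Z` agrees with `R i` on the
range of `E i`. Hence `Z w_ij = R i w_ij = χ_ij` (`apply_measVec`): only the diagonal blocks enter.
So `q i σ i` is proportional to `Z * E i * Z`, these operators sum to a multiple of `Z * Z`, and the
pretty good measurement cancels both factors `Z`.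

The square of the diagonal block is the matrix of `E i` in the `ψ_ik`, so positivity determines the
block, then `χ`, then `w = Z⁻¹ χ`, then `W`. Running this backwards constructs `W`. Finally the `w`
are orthonormal, so the `χ_ij` are independent and the blocks are invertible. -/

lemma ketbra_apply (v x : H) : ketbra v x = inner ℂ v x • v := rfl

lemma isPositive_ketbra (v : H) : (ketbra v).IsPositive :=
  InnerProductSpace.isPositive_rankOne_self v

lemma isPositive_sum_ketbra {ι : Type*} [Fintype ι] (v : ι → H) :
    (∑ j, ketbra (v j)).IsPositive :=
  ContinuousLinearMap.isPositive_sum _ fun j _ => isPositive_ketbra (v j)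

lemma sum_ketbra_apply {ι : Type*} [Fintype ι] (v : ι → H) (x : H) :
    (∑ j, ketbra (v j)) x = ∑ j, inner ℂ (v j) x • v j := by
  simp [ketbra_apply]

lemma inner_sum_ketbra_apply {ι : Type*} [Fintype ι] (v : ι → H) (x y : H) :
    inner ℂ x ((∑ j, ketbra (v j)) y) = ∑ j, inner ℂ x (v j) * inner ℂ (v j) y := by
  rw [sum_ketbra_apply, inner_sum]
  simp_rw [inner_smul_right, mul_comm]

lemma re_inner_sum_ketbra_apply_self {ι : Type*} [Fintype ι] (v : ι → H) (x : H) :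
    (inner ℂ x ((∑ j, ketbra (v j)) x)).re = ∑ j, ‖inner ℂ (v j) x‖ ^ 2 := by
  rw [inner_sum_ketbra_apply, Complex.re_sum]
  refine Finset.sum_congr rfl fun j _ => ?_
  rw [← inner_conj_symm x (v j), ← Complex.normSq_eq_conj_mul_self, Complex.normSq_eq_norm_sq,
    Complex.ofReal_re]

lemma inner_eq_zero_of_re_inner_sum_ketbra_nonpos {ι : Type*} [Fintype ι] {v : ι → H} {x : H}
    (hx : (inner ℂ x ((∑ j, ketbra (v j)) x)).re ≤ 0) (j : ι) : inner ℂ (v j) x = 0 := by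
  rw [re_inner_sum_ketbra_apply_self] at hx
  have h := (Finset.sum_eq_zero_iff_of_nonneg (fun j _ => sq_nonneg ‖inner ℂ (v j) x‖)).1
    (hx.antisymm (by positivity)) j (Finset.mem_univ j)
  simpa using h

lemma supp_smul {c : ℂ} (hc : c ≠ 0) (A : H →L[ℂ] H) : supp (c • A) = supp A := by
  simpa [supp] using LinearMap.range_smul (A : H →ₗ[ℂ] H) c hc

lemma tr_add (A B : H →L[ℂ] H) : tr (A + B) = tr A + tr B := by simp [tr]

lemma tr_sub (A B : H →L[ℂ] H) : tr (A - B) = tr A - tr B := by simp [tr]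

lemma tr_smul (c : ℂ) (A : H →L[ℂ] H) : tr (c • A) = c * tr A := by simp [tr]

lemma tr_sum {ι : Type*} (s : Finset ι) (A : ι → H →L[ℂ] H) :
    tr (∑ i ∈ s, A i) = ∑ i ∈ s, tr (A i) := by simp [tr]

lemma tr_mul_comm (A B : H →L[ℂ] H) : tr (A * B) = tr (B * A) :=
  LinearMap.trace_mul_comm ℂ (A : H →ₗ[ℂ] H) (B : H →ₗ[ℂ] H)

section Complete

variable [CompleteSpace H]

lemma mul_ketbra_mul {A : H →L[ℂ] H} (hA : IsSelfAdjoint A) (v : H) :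
    A * ketbra v * A = ketbra (A v) := by
  ext x
  have := ContinuousLinearMap.adjoint_inner_left A x v
  rw [hA.adjoint_eq] at this
  simp [ketbra_apply, this]

lemma mul_sum_ketbra_mul {A : H →L[ℂ] H} (hA : IsSelfAdjoint A) {ι : Type*} [Fintype ι]
    (v : ι → H) : A * (∑ j, ketbra (v j)) * A = ∑ j, ketbra (A (v j)) := by
  simp_rw [Finset.mul_sum, Finset.sum_mul, mul_ketbra_mul hA]

/-- Cyclicity turns the trace into a squared Hilbert–Schmidt norm, so it is nonnegative and vanishes
only if `√A √B = 0`, hence only if `A * B = 0`. -/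
lemma tr_mul_eq_tr_star_mul_self {A B : H →L[ℂ] H} (hA : A.IsPositive) (hB : B.IsPositive) :
    tr (A * B) = tr (star (CFC.sqrt A * CFC.sqrt B) * (CFC.sqrt A * CFC.sqrt B)) := by
  have hA' := CFC.sqrt_mul_sqrt_self A ((ContinuousLinearMap.nonneg_iff_isPositive A).2 hA)
  have hB' := CFC.sqrt_mul_sqrt_self B ((ContinuousLinearMap.nonneg_iff_isPositive B).2 hB)
  rw [star_mul, (CFC.sqrt_nonneg A).isSelfAdjoint.star_eq,
    (CFC.sqrt_nonneg B).isSelfAdjoint.star_eq, mul_assoc, tr_mul_comm (CFC.sqrt B),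
    ← mul_assoc (CFC.sqrt A), hA', mul_assoc, hB']

lemma mul_self_rpow_neg_half {Y : H →L[ℂ] H} (hY : 0 ≤ Y) (hu : IsUnit Y) :
    (Y * Y) ^ (-1 / 2 : ℝ) * Y = 1 ∧ Y * (Y * Y) ^ (-1 / 2 : ℝ) = 1 := by
  have h0 : 0 ≤ Y * Y := hY.isSelfAdjoint.mul_self_nonneg
  have hp : IsStrictlyPositive (Y * Y) := IsStrictlyPositive.iff_of_unital.2 ⟨h0, hu.mul hu⟩
  have hs : (Y * Y) ^ (1 / 2 : ℝ) = Y := by rw [← CFC.sqrt_eq_rpow, CFC.sqrt_mul_self Y hY]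
  have h1 := CFC.rpow_neg_mul_rpow (1 / 2 : ℝ) hp
  have h2 := CFC.rpow_mul_rpow_neg (1 / 2 : ℝ) hp
  rw [hs] at h1 h2
  rw [neg_div]
  exact ⟨h1, h2⟩

end Complete

variable [FiniteDimensional ℂ H]

lemma tr_ketbra_mul (v : H) (A : H →L[ℂ] H) : tr (ketbra v * A) = inner ℂ v (A v) := by
  rw [tr_mul_comm]
  have : ((A * ketbra v : H →L[ℂ] H) : H →ₗ[ℂ] H) =
      (innerSL ℂ v : H →ₗ[ℂ] ℂ).smulRight (A v) := by
    ext x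
    simp [ketbra_apply]
  rw [tr, this, LinearMap.trace_smulRight]
  simp

lemma tr_ketbra (v : H) : tr (ketbra v) = (‖v‖ ^ 2 : ℝ) := by
  simpa using tr_ketbra_mul v 1

lemma supp_sum_ketbra {ι : Type*} [Fintype ι] (v : ι → H) :
    supp (∑ j, ketbra (v j)) = Submodule.span ℂ (Set.range v) := by
  apply le_antisymm
  · rintro _ ⟨x, rfl⟩
    rw [ContinuousLinearMap.coe_coe, sum_ketbra_apply]
    exact Submodule.sum_mem _ fun j _ => Submodule.smul_mem _ _ (Submodule.subset_span ⟨j, rfl⟩)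
  · rw [Submodule.span_le]
    rintro _ ⟨j, rfl⟩
    -- The range is the orthogonal complement of the kernel, and a kernel vector is orthogonal to
    -- every `v j`.
    have hs := (isPositive_sum_ketbra v).isSymmetric.orthogonal_range
    rw [SetLike.mem_coe, supp, ← Submodule.orthogonal_orthogonal (LinearMap.range _), hs,
      Submodule.mem_orthogonal']
    intro x hx
    have hx0 : (∑ j, ketbra (v j)) x = 0 := hx
    exact inner_eq_zero_of_re_inner_sum_ketbra_nonpos (by simp [hx0]) j

/-- A family of `dim H` vectors that resolves the identity is orthonormal. -/
lemma orthonormal_of_sum_ketbra_eq_one {ι : Type*} [Fintype ι] {v : ι → H}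
    (hc : Fintype.card ι = Module.finrank ℂ H) (hv : ∑ j, ketbra (v j) = 1) :
    Orthonormal ℂ v := by
  classical
  have hli : LinearIndependent ℂ v := by
    refine linearIndependent_of_top_le_span_of_card_eq_finrank ?_ hc
    rw [← supp_sum_ketbra, hv]
    exact fun x _ => ⟨x, rfl⟩
  rw [orthonormal_iff_ite]
  intro a b
  -- Both `⟨v j, v b⟩` and the Kronecker delta are coefficients of `v b` in the independent family
  -- `v`.
  have h : ∑ j, (inner ℂ (v j) (v b) - if j = b then 1 else 0) • v j = 0 := by
    simp_rw [sub_smul]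
    rw [Finset.sum_sub_distrib, ← sum_ketbra_apply, hv]
    simp
  exact sub_eq_zero.1 (Fintype.linearIndependent_iff.1 hli _ h a)

variable [CompleteSpace H]

lemma tr_star_mul_self (T : H →L[ℂ] H) :
    tr (star T * T) = (∑ i, ‖T (stdOrthonormalBasis ℂ H i)‖ ^ 2 : ℝ) := by
  rw [tr, LinearMap.trace_eq_sum_inner _ (stdOrthonormalBasis ℂ H)]
  push_cast
  refine Finset.sum_congr rfl fun i _ => ?_
  simp [ContinuousLinearMap.star_eq_adjoint, ContinuousLinearMap.adjoint_inner_right]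

lemma eq_zero_of_re_tr_star_mul_self_eq_zero {T : H →L[ℂ] H} (h : (tr (star T * T)).re = 0) :
    T = 0 := by
  rw [tr_star_mul_self, Complex.ofReal_re,
    Finset.sum_eq_zero_iff_of_nonneg (fun j _ => sq_nonneg _)] at h
  have : (T : H →ₗ[ℂ] H) = 0 :=
    (stdOrthonormalBasis ℂ H).toBasis.ext fun i => by simpa using h i (Finset.mem_univ i)
  exact ContinuousLinearMap.coe_injective this

lemma re_tr_mul_nonneg {A B : H →L[ℂ] H} (hA : A.IsPositive) (hB : B.IsPositive) :
    0 ≤ (tr (A * B)).re := by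
  rw [tr_mul_eq_tr_star_mul_self hA hB, tr_star_mul_self, Complex.ofReal_re]
  positivity

lemma mul_eq_zero_of_re_tr_mul_eq_zero {A B : H →L[ℂ] H} (hA : A.IsPositive) (hB : B.IsPositive)
    (h : (tr (A * B)).re = 0) : A * B = 0 := by
  rw [tr_mul_eq_tr_star_mul_self hA hB] at h
  have h0 := eq_zero_of_re_tr_star_mul_self_eq_zero h
  rw [← CFC.sqrt_mul_sqrt_self A ((ContinuousLinearMap.nonneg_iff_isPositive A).2 hA),
    ← CFC.sqrt_mul_sqrt_self B ((ContinuousLinearMap.nonneg_iff_isPositive B).2 hB), mul_assoc,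
    ← mul_assoc _ (CFC.sqrt B), h0]
  simp

end Operators

/-! ### First-order optimality conditions by perturbing the measurement. -/

section Optimality

variable {H : Type*} [NormedAddCommGroup H] [InnerProductSpace ℂ H] {m : ℕ}

/-- The measurement obtained from `E` by tilting it towards the outcome `k` along `v`. -/
noncomputable def tilt (E : Fin m → H →L[ℂ] H) (v : H) (k : Fin m) (ε : ℝ) (i : Fin m) :
    H →L[ℂ] H :=
  (1 - (ε : ℂ) • ketbra v) * E i * (1 - (ε : ℂ) • ketbra v) +
    if i = k then ((ε * (2 - ε) : ℝ) : ℂ) • ketbra v else 0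

/-- For a unit vector, `(1 - εP)² = 1 - ε(2 - ε)P` with `P = |v⟩⟨v|`; the term given to outcome `k`
restores exactly what is lost. -/
lemma isPOVM_tilt [CompleteSpace H] {E : Fin m → H →L[ℂ] H} (hE : IsPOVM E) {v : H}
    (hv : ‖v‖ = 1) (k : Fin m) {ε : ℝ} (h0 : 0 ≤ ε) (h2 : ε ≤ 2) : IsPOVM (tilt E v k ε) where
  pos i := by
    have hs : IsSelfAdjoint (1 - (ε : ℂ) • ketbra v) := by
      refine (IsSelfAdjoint.one _).sub (IsSelfAdjoint.smul ?_ (isPositive_ketbra v).isSelfAdjoint)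
      exact Complex.conj_ofReal ε
    refine ContinuousLinearMap.IsPositive.add ?_ ?_
    · have := (hE.pos i).conj_adjoint (1 - (ε : ℂ) • ketbra v)
      rw [hs.adjoint_eq] at this
      exact this
    · split_ifs
      · refine (isPositive_ketbra v).smul_of_nonneg ?_
        have : 0 ≤ ε * (2 - ε) := mul_nonneg h0 (by linarith)
        exact_mod_cast this
      · exact ContinuousLinearMap.isPositive_zero
  sum_eq := by
    have hP : ketbra v * ketbra v = ketbra v :=
      InnerProductSpace.isIdempotentElem_rankOne_self hv
    simp only [tilt, Finset.sum_add_distrib, Finset.sum_ite_eq', Finset.mem_univ, if_true]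
    rw [← Finset.sum_mul, ← Finset.mul_sum, hE.sum_eq]
    simp only [mul_one, sub_mul, mul_sub, one_mul, smul_mul_assoc, mul_smul_comm, hP]
    push_cast
    module

lemma re_tr_mul_tilt [FiniteDimensional ℂ H] (R E : Fin m → H →L[ℂ] H) (v : H) (k : Fin m)
    (ε : ℝ) (i : Fin m) :
    (tr (R i * tilt E v k ε i)).re = (tr (R i * E i)).re -
      ε * (inner ℂ v ((R i * E i + E i * R i) v)).re +
      ε ^ 2 * (tr (R i * (ketbra v * E i * ketbra v))).re +
      if i = k then ε * (2 - ε) * (inner ℂ v (R i v)).re else 0 := by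
  have h1 : tr (R i * (ketbra v * E i)) = inner ℂ v ((E i * R i) v) := by
    rw [tr_mul_comm, mul_assoc, tr_ketbra_mul]
  have h2 : tr (R i * (E i * ketbra v)) = inner ℂ v ((R i * E i) v) := by
    rw [← mul_assoc, tr_mul_comm, tr_ketbra_mul]
  have h3 : tr (R i * ketbra v) = inner ℂ v (R i v) := by rw [tr_mul_comm, tr_ketbra_mul]
  have h4 : R i * tilt E v k ε i = R i * E i - (ε : ℂ) • (R i * (ketbra v * E i)) -
      (ε : ℂ) • (R i * (E i * ketbra v)) +
      ((ε ^ 2 : ℝ) : ℂ) • (R i * (ketbra v * E i * ketbra v)) +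
      if i = k then ((ε * (2 - ε) : ℝ) : ℂ) • (R i * ketbra v) else 0 := by
    simp only [tilt, mul_one, sub_mul, mul_sub, one_mul, smul_mul_assoc, mul_smul_comm, mul_add,
      mul_ite, mul_zero]
    congr 1
    push_cast
    module
  rw [h4]
  simp only [tr_add, tr_sub, tr_smul, h1, h2, _root_.add_apply, inner_add_right,
    Complex.add_re, Complex.sub_re, Complex.re_ofReal_mul]
  split_ifs
  · rw [tr_smul, h3, Complex.re_ofReal_mul]
    ring
  · simp only [tr, ContinuousLinearMap.toLinearMap_zero, map_zero, Complex.zero_re]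
    ring

/-- The Hermitian part of `∑ i, R i * E i`. -/
noncomputable def lagrange (R E : Fin m → H →L[ℂ] H) : H →L[ℂ] H :=
  (2⁻¹ : ℂ) • ∑ i, (R i * E i + E i * R i)

lemma isSelfAdjoint_lagrange [CompleteSpace H] {R E : Fin m → H →L[ℂ] H}
    (hR : ∀ i, IsSelfAdjoint (R i)) (hE : ∀ i, IsSelfAdjoint (E i)) :
    IsSelfAdjoint (lagrange R E) := by
  refine IsSelfAdjoint.smul (by simp [IsSelfAdjoint]) ?_
  refine isSelfAdjoint_sum _ fun i _ => ?_
  rw [IsSelfAdjoint, star_add, star_mul, star_mul, (hR i).star_eq, (hE i).star_eq, add_comm]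

lemma nonpos_of_forall_mul_add_sq_mul_nonpos {a b : ℝ}
    (h : ∀ ε : ℝ, 0 < ε → ε ≤ 1 → ε * a + ε ^ 2 * b ≤ 0) : a ≤ 0 := by
  by_contra! ha
  have hd : 0 < a + |b| := by positivity
  have hb := neg_abs_le b
  have h0 : 0 ≤ |b| := abs_nonneg b
  set ε := a / (2 * (a + |b|)) with hε
  have hε0 : 0 < ε := by positivity
  have hε1 : ε * (2 * (a + |b|)) = a := by rw [hε]; field_simp
  have hle : ε ≤ 1 := by rw [hε, div_le_one (by positivity)]; linarith
  have := h ε hε0 hle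
  have h2 : a + ε * b ≤ 0 := by
    by_contra! hc
    nlinarith [mul_pos hε0 hc]
  nlinarith [mul_le_mul_of_nonneg_left hb hε0.le, mul_pos hε0 ha]

/-- The necessary optimality conditions for minimum error discrimination. -/
lemma lagrange_optimality [CompleteSpace H] [FiniteDimensional ℂ H] {R E : Fin m → H →L[ℂ] H}
    (hR : ∀ i, (R i).IsPositive) (hE : IsPOVM E)
    (hopt : ∀ F : Fin m → H →L[ℂ] H, IsPOVM F →
      ∑ i, (tr (R i * F i)).re ≤ ∑ i, (tr (R i * E i)).re) :
    (∀ i, (lagrange R E - R i).IsPositive) ∧ ∀ i, (lagrange R E - R i) * E i = 0 := by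
  have hsa := isSelfAdjoint_lagrange (fun i => (hR i).isSelfAdjoint)
    (fun i => (hE.pos i).isSelfAdjoint)
  have hunit : ∀ k, ∀ v : H, ‖v‖ = 1 → 0 ≤ (inner ℂ v ((lagrange R E - R k) v)).re := by
    intro k v hv
    have h2 : ∑ i, (inner ℂ v ((R i * E i + E i * R i) v)).re =
        2 * (inner ℂ v (lagrange R E v)).re := by
      rw [lagrange, _root_.smul_apply, _root_.sum_apply,
        inner_smul_right, inner_sum, ← Complex.re_sum]
      have : (2⁻¹ : ℂ) = ((2⁻¹ : ℝ) : ℂ) := by push_cast; rfl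
      rw [this, Complex.re_ofReal_mul]
      ring
    -- The left side is the coefficient of `ε` in the change of success probability under the tilt,
    -- and `b` is that of `ε ^ 2`.
    have key : -2 * (inner ℂ v ((lagrange R E - R k) v)).re ≤ 0 := by
      refine nonpos_of_forall_mul_add_sq_mul_nonpos
        (b := ∑ i, (tr (R i * (ketbra v * E i * ketbra v))).re - (inner ℂ v (R k v)).re) ?_
      intro ε h0 h1
      have h := hopt _ (isPOVM_tilt hE hv k h0.le (by linarith))
      simp_rw [re_tr_mul_tilt, Finset.sum_add_distrib, Finset.sum_sub_distrib, ← Finset.mul_sum,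
        Finset.sum_ite_eq', Finset.mem_univ, if_true, h2] at h
      rw [_root_.sub_apply, inner_sub_right, Complex.sub_re]
      linarith
    linarith
  have hpos : ∀ i, (lagrange R E - R i).IsPositive := by
    intro k
    refine ⟨((hsa.sub (hR k).isSelfAdjoint)).isSymmetric, fun x => ?_⟩
    rw [ContinuousLinearMap.reApplyInnerSelf_apply, inner_re_symm]
    by_cases hx : x = 0
    · simp [hx]
    · have hn : ‖x‖ ≠ 0 := norm_ne_zero_iff.2 hx
      have h := hunit k (((‖x‖⁻¹ : ℝ) : ℂ) • x) (by simp [norm_smul, hn])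
      rw [map_smul, inner_smul_left, inner_smul_right, Complex.conj_ofReal, Complex.re_ofReal_mul,
        Complex.re_ofReal_mul] at h
      have h3 : 0 < ‖x‖⁻¹ := by positivity
      exact (mul_nonneg_iff_of_pos_left h3).1 ((mul_nonneg_iff_of_pos_left h3).1 h)
  refine ⟨hpos, fun i => ?_⟩
  -- Since `∑ E i = 1`, both parts have total trace `tr Z`; nonnegative summands then vanish one by
  -- one.
  have hsum : ∑ i, (tr ((lagrange R E - R i) * E i)).re = 0 := by
    simp_rw [sub_mul, tr_sub, Complex.sub_re]
    rw [Finset.sum_sub_distrib, ← Complex.re_sum, ← tr_sum, ← Finset.mul_sum, hE.sum_eq, mul_one,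
      lagrange, tr_smul, tr_sum]
    simp_rw [tr_add, tr_mul_comm (E _) (R _), ← two_mul]
    rw [← Finset.mul_sum, ← mul_assoc]
    simp
  have hzero := (Finset.sum_eq_zero_iff_of_nonneg
    (fun i _ => re_tr_mul_nonneg (hpos i) (hE.pos i))).1 hsum i (Finset.mem_univ i)
  exact mul_eq_zero_of_re_tr_mul_eq_zero (hpos i) (hE.pos i) hzero

end Optimality

/-! ### Matrices as inner products against the basis `ψ`. -/

section Frame

variable {H : Type*} [NormedAddCommGroup H] [InnerProductSpace ℂ H] {m : ℕ} {r : Fin m → ℕ}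
  {ψ : Idx r → H}

lemma eq_of_forall_inner_eq {ι : Type*} {φ : ι → H} (hsp : Submodule.span ℂ (Set.range φ) = ⊤)
    {x y : H} (h : ∀ a, inner ℂ (φ a) x = inner ℂ (φ a) y) : x = y := by
  have h0 : ∀ z : H, inner ℂ z (x - y) = 0 := by
    intro z
    have hz : z ∈ Submodule.span ℂ (Set.range φ) := hsp ▸ Submodule.mem_top
    induction hz using Submodule.span_induction with
    | mem z hz =>
      obtain ⟨a, rfl⟩ := hz
      rw [inner_sub_right, h, sub_self]
    | zero => simp
    | add a b _ _ ha hb => rw [inner_add_left, ha, hb, add_zero]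
    | smul c a _ ha => rw [inner_smul_left, ha, mul_zero]
  exact sub_eq_zero.1 (inner_self_eq_zero.1 (h0 (x - y)))

lemma posDef_G (hli : LinearIndependent ℂ ψ) : (G ψ).PosDef :=
  Matrix.posDef_gram_of_linearIndependent hli

lemma inner_dualVec (hli : LinearIndependent ℂ ψ) (c b : Idx r) :
    inner ℂ (ψ c) (dualVec ψ b) = (1 : Matrix (Idx r) (Idx r) ℂ) c b := by
  have hu : IsUnit (G ψ).det := (Matrix.isUnit_iff_isUnit_det _).1 (posDef_G hli).isUnit
  rw [← Matrix.mul_nonsing_inv (G ψ) hu, Matrix.mul_apply, dualVec, inner_sum]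
  simp_rw [inner_smul_right, G, Matrix.gram_apply, mul_comm]

lemma inner_measVec (hli : LinearIndependent ℂ ψ) (W : Matrix (Idx r) (Idx r) ℂ) (c b : Idx r) :
    inner ℂ (ψ c) (measVec ψ W b) = rootMul ψ W c b := by
  rw [measVec, inner_sum]
  simp_rw [inner_smul_right, inner_dualVec hli]
  simp [Matrix.one_apply]

lemma isUnit_sqrt_G (hli : LinearIndependent ℂ ψ) : IsUnit (CFC.sqrt (G ψ)) := by
  have h := CFC.sqrt_mul_sqrt_self (G ψ) (posDef_G hli).posSemidef.nonneg
  have hu := (posDef_G hli).isUnit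
  rw [← h] at hu
  exact isUnit_of_mul_isUnit_left hu

lemma rootMul_injective (hli : LinearIndependent ℂ ψ) : Function.Injective (rootMul ψ) :=
  fun _ _ h => (isUnit_sqrt_G hli).mul_left_cancel h

lemma measVec_injective (hli : LinearIndependent ℂ ψ) : Function.Injective (measVec ψ) := by
  intro W W' h
  refine rootMul_injective hli (Matrix.ext fun c b => ?_)
  rw [← inner_measVec hli, ← inner_measVec hli, h]

/-- Every family of vectors that resolves the identity comes from a unitary matrix. -/
lemma exists_unitary_measVec_eq (hli : LinearIndependent ℂ ψ)
    (hsp : Submodule.span ℂ (Set.range ψ) = ⊤) {v : Idx r → H} (hv : ∑ b, ketbra (v b) = 1) :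
    ∃ W ∈ Matrix.unitaryGroup (Idx r) ℂ, measVec ψ W = v := by
  set S := CFC.sqrt (G ψ) with hS
  have hSS : S * S = G ψ := CFC.sqrt_mul_sqrt_self (G ψ) (posDef_G hli).posSemidef.nonneg
  have hSa : star S = S := (CFC.sqrt_nonneg (G ψ)).isSelfAdjoint.star_eq
  obtain ⟨s, hs⟩ := isUnit_sqrt_G hli
  rw [← hS] at hs
  set M : Matrix (Idx r) (Idx r) ℂ := Matrix.of fun c b => inner ℂ (ψ c) (v b) with hM
  -- Parseval's identity for the resolution `v`: `M * star M` is the Gram matrix. Hence `G^(-1/2) M`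
  -- is unitary.
  have hMM : M * star M = S * S := by
    rw [hSS]
    ext a c
    have h := inner_sum_ketbra_apply v (ψ a) (ψ c)
    rw [hv] at h
    simp only [one_apply_eq_self] at h
    simp [Matrix.mul_apply, hM, G, Matrix.gram_apply, h]
  have hsS : (↑s⁻¹ : Matrix (Idx r) (Idx r) ℂ) * S = 1 := by rw [← hs, s.inv_mul]
  have hSs : S * (↑s⁻¹ : Matrix (Idx r) (Idx r) ℂ) = 1 := by rw [← hs, s.mul_inv]
  have hss : S * star (↑s⁻¹ : Matrix (Idx r) (Idx r) ℂ) = 1 := by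
    rw [← hSa, ← star_mul, hsS, star_one]
  refine ⟨(↑s⁻¹ : Matrix (Idx r) (Idx r) ℂ) * M, ?_, ?_⟩
  · rw [Matrix.mem_unitaryGroup_iff, star_mul, mul_assoc, ← mul_assoc M, hMM, mul_assoc S, hss,
      mul_one, hsS]
  · funext b
    refine eq_of_forall_inner_eq hsp fun c => ?_
    rw [inner_measVec hli, rootMul, ← hS, ← mul_assoc, hSs, one_mul]
    rfl

lemma X_apply (W : Matrix (Idx r) (Idx r) ℂ) (i : Fin m) (k j : Fin (r i)) :
    X ψ W i k j = rootMul ψ W ⟨i, k⟩ ⟨i, j⟩ := rfl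

end Frame

/-! ### Existence and uniqueness of the adapted unitary. -/

section Adapted

variable {H : Type*} [NormedAddCommGroup H] [InnerProductSpace ℂ H]

lemma mulVec_sum_smul {ι : Type*} [Fintype ι] (A : Matrix ι ι ℂ) (φ : ι → H) (c : ι → ℂ) :
    ∑ j, c j • ∑ k, A k j • φ k = ∑ k, (A.mulVec c) k • φ k := by
  simp_rw [Finset.smul_sum, smul_smul]
  rw [Finset.sum_comm]
  refine Finset.sum_congr rfl fun k _ => ?_
  simp_rw [Matrix.mulVec, dotProduct, Finset.sum_smul, mul_comm]

/-- The matrix of `A` with respect to the family `φ`. -/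
noncomputable def sandwich {ι : Type*} (A : H →L[ℂ] H) (φ : ι → H) : Matrix ι ι ℂ :=
  Matrix.of fun k l => inner ℂ (φ k) (A (φ l))

lemma posSemidef_sandwich [CompleteSpace H] {ι : Type*} [Finite ι] {A : H →L[ℂ] H}
    (hA : A.IsPositive) (φ : ι → H) : (sandwich A φ).PosSemidef := by
  have h : sandwich A φ = Matrix.gram ℂ fun k => CFC.sqrt A (φ k) := by
    ext k l
    rw [Matrix.gram_apply, ← ContinuousLinearMap.adjoint_inner_right,
      (CFC.sqrt_nonneg A).isSelfAdjoint.adjoint_eq, ← mul_apply_eq_comp,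
      CFC.sqrt_mul_sqrt_self A ((ContinuousLinearMap.nonneg_iff_isPositive A).2 hA)]
    rfl
  rw [h]
  exact Matrix.posSemidef_gram ℂ _

/-- With `R = ∑ |φ k⟩⟨φ k|`, the matrix `sandwich A φ` holds the coefficients of `R * A * R` in the
operators `|φ k⟩⟨φ l|`, so any factor `Y` of it decomposes `R * A * R`. -/
lemma sum_ketbra_eq_of_mul_conjTranspose_eq {ι : Type*} [Fintype ι] {A : H →L[ℂ] H} {φ : ι → H}
    {Y : Matrix ι ι ℂ} (hY : Y * Y.conjTranspose = sandwich A φ) :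
    ∑ j, ketbra (∑ k, Y k j • φ k) = (∑ k, ketbra (φ k)) * A * ∑ k, ketbra (φ k) := by
  have hkl : ∀ k l, inner ℂ (φ k) (A (φ l)) = ∑ j, Y k j * star (Y l j) := fun k l => by
    have := congrFun (congrFun hY k) l
    simpa [Matrix.mul_apply, sandwich] using this.symm
  ext x
  rw [mul_apply_eq_comp, mul_apply_eq_comp, sum_ketbra_apply,
    sum_ketbra_apply φ x, sum_ketbra_apply φ]
  simp_rw [map_sum, map_smul, inner_sum, inner_smul_right, hkl, sum_inner, inner_smul_left,
    Finset.smul_sum, smul_smul, Finset.sum_smul, Finset.mul_sum, Finset.sum_mul, Finset.sum_smul]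
  rw [Finset.sum_comm]
  refine Finset.sum_congr rfl fun k _ => ?_
  rw [Finset.sum_comm]
  refine Finset.sum_congr rfl fun l _ => Finset.sum_congr rfl fun j _ => ?_
  congr 1
  simp only [RCLike.star_def]
  ring

variable {m : ℕ} {r : Fin m → ℕ} {ψ : Idx r → H}

/-- Each `v j` lies in the range of `A`, where `Z` coincides with `∑ |φ k⟩⟨φ k|`. -/
lemma apply_eq_of_resolves [FiniteDimensional ℂ H] {Z A : H →L[ℂ] H} {ι : Type*} [Fintype ι]
    {φ v : ι → H} (hZ : (Z - ∑ k, ketbra (φ k)) * A = 0)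
    (hA : A = ∑ j, ketbra (v j)) (j : ι) :
    Z (v j) = ∑ k, inner ℂ (φ k) (v j) • φ k := by
  have hv : v j ∈ supp A := by
    rw [hA, supp_sum_ketbra]
    exact Submodule.subset_span ⟨j, rfl⟩
  obtain ⟨x, hx⟩ := hv
  have h := congrArg (fun T : H →L[ℂ] H => T x) hZ
  have hx' : A x = v j := hx
  simp only [mul_apply_eq_comp, hx', _root_.sub_apply, _root_.zero_apply] at h
  rw [← sum_ketbra_apply]
  exact sub_eq_zero.1 h

lemma apply_measVec [FiniteDimensional ℂ H] (hli : LinearIndependent ℂ ψ) {E : Fin m → H →L[ℂ] H}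
    {Z : H →L[ℂ] H} (hZE : ∀ i, (Z - ∑ k, ketbra (ψ ⟨i, k⟩)) * E i = 0)
    {W : Matrix (Idx r) (Idx r) ℂ} (hW : IsAdapted ψ E W) (i : Fin m) (j : Fin (r i)) :
    Z (measVec ψ W ⟨i, j⟩) = chi ψ W i j := by
  rw [apply_eq_of_resolves (v := fun j => measVec ψ W ⟨i, j⟩) (hZE i) (hW.resolves i) j]
  simp_rw [inner_measVec hli]
  rfl

lemma X_mul_self (hli : LinearIndependent ℂ ψ) {E : Fin m → H →L[ℂ] H}
    {W : Matrix (Idx r) (Idx r) ℂ} (hW : IsAdapted ψ E W) (i : Fin m) :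
    X ψ W i * X ψ W i = sandwich (E i) fun k => ψ ⟨i, k⟩ := by
  nth_rw 2 [← (hW.posSemidef i).isHermitian.eq]
  ext k l
  simp only [Matrix.mul_apply, Matrix.conjTranspose_apply, X_apply, ← inner_measVec hli, sandwich,
    Matrix.of_apply, hW.resolves i, inner_sum_ketbra_apply]
  simp

lemma adapted_unique [FiniteDimensional ℂ H] (hli : LinearIndependent ℂ ψ)
    {E : Fin m → H →L[ℂ] H} {Z : H →L[ℂ] H}
    (hZ : Function.Injective Z) (hZE : ∀ i, (Z - ∑ k, ketbra (ψ ⟨i, k⟩)) * E i = 0)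
    {W W' : Matrix (Idx r) (Idx r) ℂ} (hW : IsAdapted ψ E W) (hW' : IsAdapted ψ E W') :
    W = W' := by
  have hX : ∀ i, X ψ W i = X ψ W' i := fun i =>
    (CFC.mul_self_eq_mul_self_iff _ _ (hW.posSemidef i).nonneg (hW'.posSemidef i).nonneg).1
      ((X_mul_self hli hW i).trans (X_mul_self hli hW' i).symm)
  refine measVec_injective hli (funext fun ⟨i, j⟩ => hZ ?_)
  rw [apply_measVec hli hZE hW, apply_measVec hli hZE hW', chi, chi, hX]

lemma exists_adapted [CompleteSpace H] [FiniteDimensional ℂ H] (hli : LinearIndependent ℂ ψ)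
    (hsp : Submodule.span ℂ (Set.range ψ) = ⊤)
    {E : Fin m → H →L[ℂ] H} (hE : IsPOVM E) {Z : H →L[ℂ] H} (hZs : IsSelfAdjoint Z)
    (hZu : IsUnit Z) (hZE : ∀ i, (Z - ∑ k, ketbra (ψ ⟨i, k⟩)) * E i = 0) :
    ∃ W, IsAdapted ψ E W := by
  set Y : ∀ i, Matrix (Fin (r i)) (Fin (r i)) ℂ :=
    fun i => CFC.sqrt (sandwich (E i) fun k => ψ ⟨i, k⟩)
  have hYpos : ∀ i, (Y i).PosSemidef := fun i => Matrix.nonneg_iff_posSemidef.1 (CFC.sqrt_nonneg _)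
  have hY : ∀ i, Y i * (Y i).conjTranspose = sandwich (E i) fun k => ψ ⟨i, k⟩ := by
    intro i
    rw [(hYpos i).isHermitian.eq]
    exact CFC.sqrt_mul_sqrt_self _ (posSemidef_sandwich (hE.pos i) _).nonneg
  -- `Y` plays the role of the diagonal blocks, so the measurement vectors must be `Z⁻¹` of the
  -- corresponding `χ`.
  have hsurj : ∀ b : Idx r, ∃ v, Z v = ∑ k, Y b.1 k b.2 • ψ ⟨b.1, k⟩ := fun b =>
    (ContinuousLinearMap.isUnit_iff_bijective.1 hZu).2 _
  choose v hv using hsurj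
  have hres : ∀ i, E i = ∑ j, ketbra (v ⟨i, j⟩) := by
    intro i
    have hRE : (∑ k, ketbra (ψ ⟨i, k⟩)) * E i = Z * E i := by
      have := hZE i
      rw [sub_mul, sub_eq_zero] at this
      exact this.symm
    have hER : E i * (∑ k, ketbra (ψ ⟨i, k⟩)) = E i * Z := by
      have := congrArg star hRE
      rwa [star_mul, star_mul, hZs.star_eq, (hE.pos i).isSelfAdjoint.star_eq,
        (isPositive_sum_ketbra fun k => ψ ⟨i, k⟩).isSelfAdjoint.star_eq] at this
    have h1 := mul_sum_ketbra_mul hZs fun j => v ⟨i, j⟩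
    simp_rw [hv] at h1
    rw [sum_ketbra_eq_of_mul_conjTranspose_eq (hY i), hRE, mul_assoc Z (E i), hER,
      ← mul_assoc] at h1
    -- `Z * E i * Z = R * E i * R = Z * (∑ |v⟩⟨v|) * Z`, with `R = ∑ |ψ_ik⟩⟨ψ_ik|`.
    exact (hZu.mul_left_cancel (hZu.mul_right_cancel h1)).symm
  have hone : ∑ b, ketbra (v b) = 1 := by
    rw [Fintype.sum_sigma, ← hE.sum_eq]
    exact Finset.sum_congr rfl fun i _ => (hres i).symm
  obtain ⟨W, hWu, hWv⟩ := exists_unitary_measVec_eq hli hsp hone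
  refine ⟨W, hWu, fun i => by rw [hWv]; exact hres i, fun i => ?_⟩
  convert hYpos i using 1
  ext k j
  rw [X_apply, ← inner_measVec hli, hWv]
  -- This expands `Z v_ij` in the `ψ_ik` a second time; independence identifies the block with `Y
  -- i`.
  have h := apply_eq_of_resolves (v := fun j => v ⟨i, j⟩) (hZE i) (hres i) j
  rw [hv, ← sub_eq_zero, ← Finset.sum_sub_distrib] at h
  simp_rw [← sub_smul] at h
  have hli' : LinearIndependent ℂ fun k => ψ ⟨i, k⟩ := hli.comp _ sigma_mk_injective
  exact (sub_eq_zero.1 (Fintype.linearIndependent_iff.1 hli' _ h k)).symm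

end Adapted

/-! ### Independence of `χ`, its span and the weights. -/

section AssociatedEnsemble

variable {H : Type*} [NormedAddCommGroup H] [InnerProductSpace ℂ H] {m : ℕ} {r : Fin m → ℕ}
  {ψ : Idx r → H} {W : Matrix (Idx r) (Idx r) ℂ}

lemma posDef_X (hW : ∀ i, (X ψ W i).PosSemidef) (i : Fin m)
    (hχ : LinearIndependent ℂ (chi ψ W i)) : (X ψ W i).PosDef := by
  rw [Matrix.PosSemidef.posDef_iff_isUnit (hW i), ← Matrix.mulVec_injective_iff_isUnit]
  intro c d hcd
  have h : ∑ j, (c - d) j • chi ψ W i j = 0 := by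
    simp only [chi]
    rw [mulVec_sum_smul, Matrix.mulVec_sub, hcd, sub_self]
    simp
  funext j
  exact sub_eq_zero.1 (Fintype.linearIndependent_iff.1 hχ _ h j)

lemma span_chi (hli : LinearIndependent ℂ ψ) (i : Fin m) (hχ : LinearIndependent ℂ (chi ψ W i)) :
    Submodule.span ℂ (Set.range (chi ψ W i)) =
      Submodule.span ℂ (Set.range fun k => ψ ⟨i, k⟩) := by
  have : FiniteDimensional ℂ (Submodule.span ℂ (Set.range fun k => ψ ⟨i, k⟩)) :=
    FiniteDimensional.span_of_finite ℂ (Set.finite_range _)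
  refine Submodule.eq_of_le_of_finrank_eq (Submodule.span_le.2 ?_) ?_
  · rintro _ ⟨j, rfl⟩
    exact Submodule.sum_mem _ fun k _ => Submodule.smul_mem _ _ (Submodule.subset_span ⟨k, rfl⟩)
  · rw [finrank_span_eq_card hχ,
      finrank_span_eq_card (b := fun k => ψ ⟨i, k⟩) (hli.comp _ sigma_mk_injective)]

lemma weight_pos {i : Fin m} (hr : 0 < r i) (hχ : LinearIndependent ℂ (chi ψ W i)) :
    0 < weight ψ W i := by
  have : Nonempty (Fin (r i)) := ⟨⟨0, hr⟩⟩
  refine Finset.sum_pos (fun j _ => ?_) Finset.univ_nonempty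
  have := norm_pos_iff.2 (hχ.ne_zero j)
  positivity

lemma q_smul_sigma {i : Fin m} (hw : weight ψ W i ≠ 0) :
    (q ψ W i : ℂ) • sigma ψ W i =
      ((∑ l, weight ψ W l : ℝ) : ℂ)⁻¹ • ∑ j, ketbra (chi ψ W i j) := by
  have hw' : (weight ψ W i : ℂ) ≠ 0 := by exact_mod_cast hw
  rw [sigma, q, smul_smul]
  congr 1
  push_cast
  field_simp

end AssociatedEnsemble

/-! ### Pretty good measurements and properties of the ensembles. -/

section Ensemble

variable {H : Type*} [NormedAddCommGroup H] [InnerProductSpace ℂ H] {m : ℕ} {r : Fin m → ℕ}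
  {p : Fin m → ℝ} {ρ : Fin m → H →L[ℂ] H} {ψ : Idx r → H}

lemma IsLIEnsemble.smul_isPositive (hP : IsLIEnsemble r p ρ) (i : Fin m) :
    ((p i : ℂ) • ρ i).IsPositive :=
  (hP.pos i).smul_of_nonneg (by exact_mod_cast (hP.prob_pos i).le)

lemma IsLIEnsemble.supp_smul (hP : IsLIEnsemble r p ρ) (i : Fin m) :
    supp ((p i : ℂ) • ρ i) = supp (ρ i) :=
  MED.supp_smul (by exact_mod_cast (hP.prob_pos i).ne') (ρ i)

lemma successProb_eq (E : Fin m → H →L[ℂ] H) :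
    successProb p ρ E = ∑ i, (tr (((p i : ℂ) • ρ i) * E i)).re := by
  simp_rw [successProb, smul_mul_assoc, tr_smul, Complex.re_ofReal_mul]

lemma IsLIEnsemble.nonempty (hP : IsLIEnsemble r p ρ) : Nonempty (Fin m) := by
  by_contra h
  rw [not_nonempty_iff] at h
  simpa using hP.prob_sum

/-- If `Z x = 0`, then `⟨x, R i x⟩ ≤ ⟨x, Z x⟩ = 0` with `R i = ∑ |ψ_ik⟩⟨ψ_ik|`, so `x` is orthogonal
to every `ψ_ik`. -/
lemma injective_of_forall_sub_isPositive (hsp : Submodule.span ℂ (Set.range ψ) = ⊤)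
    {Z : H →L[ℂ] H} (hZ : ∀ i, (Z - ∑ k, ketbra (ψ ⟨i, k⟩)).IsPositive) :
    Function.Injective Z := by
  rw [injective_iff_map_eq_zero]
  intro x hx
  refine eq_of_forall_inner_eq hsp fun ⟨i, k⟩ => ?_
  rw [inner_zero_right]
  refine inner_eq_zero_of_re_inner_sum_ketbra_nonpos (v := fun k => ψ ⟨i, k⟩) ?_ k
  have h := (hZ i).re_inner_nonneg_right x
  rw [_root_.sub_apply, hx, zero_sub, inner_neg_right, map_neg] at h
  exact neg_nonneg.1 h

/-- If `Z` is positive and invertible, the operators `E i` with `∑ i, E i = 1` form the pretty good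
measurement of any ensemble proportional to `Z * E i * Z`. -/
lemma eq_pgm_of_smul_eq [CompleteSpace H] {E σ : Fin m → H →L[ℂ] H} {s : Fin m → ℝ}
    {Z : H →L[ℂ] H} {c : ℝ} (hE : ∑ i, E i = 1) (hZ : Z.IsPositive) (hu : IsUnit Z) (hc : 0 < c)
    (h : ∀ i, (s i : ℂ) • σ i = (c : ℂ)⁻¹ • (Z * E i * Z)) (i : Fin m) : E i = pgm s σ i := by
  set t : ℂ := (((√c)⁻¹ : ℝ) : ℂ) with ht
  have ht0 : 0 ≤ t := by
    rw [ht]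
    exact_mod_cast (inv_nonneg.2 (Real.sqrt_nonneg c))
  have htu : t ≠ 0 := by
    rw [ht]
    exact_mod_cast (inv_pos.2 (Real.sqrt_pos.2 hc)).ne'
  have htt : t * t = (c : ℂ)⁻¹ := by
    rw [ht, ← Complex.ofReal_mul, ← mul_inv, Real.mul_self_sqrt hc.le, Complex.ofReal_inv]
  -- Rescaling by `1/√c` absorbs the normalisation: the average state becomes `Y * Y`, whose power
  -- `-1/2` is `Y⁻¹`.
  set Y : H →L[ℂ] H := t • Z with hY
  have hYE : ∀ i, (s i : ℂ) • σ i = Y * E i * Y := fun i => by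
    rw [h i, hY, smul_mul_assoc, smul_mul_assoc, mul_smul_comm, smul_smul, htt]
  have hY0 : 0 ≤ Y := (ContinuousLinearMap.nonneg_iff_isPositive _).2 (hZ.smul_of_nonneg ht0)
  have hYu : IsUnit Y := by
    have := hu.smul (Units.mk0 t htu)
    rwa [Units.smul_mk0] at this
  have hS : ∑ j, (s j : ℂ) • σ j = Y * Y := by
    simp_rw [hYE]
    rw [← Finset.sum_mul, ← Finset.mul_sum, hE, mul_one]
  obtain ⟨h1, h2⟩ := mul_self_rpow_neg_half hY0 hYu
  rw [pgm, hS, hYE]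
  simp only [← mul_assoc]
  rw [h1, one_mul, mul_assoc, h2, mul_one]

variable [FiniteDimensional ℂ H]

lemma IsLIEnsemble.sum_rank (hP : IsLIEnsemble r p ρ) : ∑ i, r i = Module.finrank ℂ H := by
  have hint := DirectSum.isInternal_submodule_of_iSupIndep_of_iSup_eq_top hP.indep hP.span
  have b := hint.collectedBasis fun i => Module.finBasis ℂ (supp (ρ i))
  rw [Module.finrank_eq_card_basis b, Fintype.card_sigma]
  exact Finset.sum_congr rfl fun i _ => by rw [Fintype.card_fin, hP.rank_eq i]

lemma IsLIEnsemble.rank_pos (hP : IsLIEnsemble r p ρ) (i : Fin m) : 0 < r i := by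
  rw [Nat.pos_iff_ne_zero]
  intro h
  have hb : supp (ρ i) = ⊥ := Submodule.finrank_eq_zero.1 ((hP.rank_eq i).trans h)
  have ht := hP.trace_one i
  rw [tr, LinearMap.range_eq_bot.1 hb, map_zero] at ht
  exact zero_ne_one ht

lemma IsDecomposition.supp_eq (hP : IsLIEnsemble r p ρ) (hψ : IsDecomposition p ρ ψ) (i : Fin m) :
    supp (ρ i) = Submodule.span ℂ (Set.range fun k => ψ ⟨i, k⟩) := by
  rw [← hP.supp_smul i, hψ i, supp_sum_ketbra]

lemma IsDecomposition.span_eq_top (hP : IsLIEnsemble r p ρ) (hψ : IsDecomposition p ρ ψ) :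
    Submodule.span ℂ (Set.range ψ) = ⊤ := by
  rw [eq_top_iff, ← hP.span]
  refine iSup_le fun i => ?_
  rw [hψ.supp_eq hP i]
  refine Submodule.span_mono ?_
  rintro _ ⟨k, rfl⟩
  exact ⟨⟨i, k⟩, rfl⟩

lemma card_Idx (hP : IsLIEnsemble r p ρ) : Fintype.card (Idx r) = Module.finrank ℂ H := by
  simp [← hP.sum_rank]

lemma IsDecomposition.linearIndependent (hP : IsLIEnsemble r p ρ) (hψ : IsDecomposition p ρ ψ) :
    LinearIndependent ℂ ψ :=
  linearIndependent_of_top_le_span_of_card_eq_finrank (hψ.span_eq_top hP).ge (card_Idx hP)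

lemma isLIEnsemble_q_sigma (hP : IsLIEnsemble r p ρ) {W : Matrix (Idx r) (Idx r) ℂ}
    (hw : ∀ i, 0 < weight ψ W i) (hs : ∀ i, supp (sigma ψ W i) = supp (ρ i)) :
    IsLIEnsemble r (q ψ W) (sigma ψ W) where
  prob_pos i := by
    have := hP.nonempty
    exact div_pos (hw i) (Finset.sum_pos (fun l _ => hw l) Finset.univ_nonempty)
  prob_sum := by
    have := hP.nonempty
    have hc : 0 < ∑ l, weight ψ W l := Finset.sum_pos (fun l _ => hw l) Finset.univ_nonempty
    simp_rw [q]
    rw [← Finset.sum_div, div_self hc.ne']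
  pos i := by
    refine (isPositive_sum_ketbra _).smul_of_nonneg ?_
    rw [← Complex.ofReal_inv]
    exact_mod_cast (inv_pos.2 (hw i)).le
  trace_one i := by
    have h : (weight ψ W i : ℂ) ≠ 0 := by exact_mod_cast (hw i).ne'
    rw [sigma, tr_smul, tr_sum]
    simp_rw [tr_ketbra]
    rw [← Complex.ofReal_sum, ← weight, inv_mul_cancel₀ h]
  rank_eq i := by rw [hs i, hP.rank_eq i]
  indep := by simp_rw [hs]; exact hP.indep
  span := by simp_rw [hs]; exact hP.span

end Ensemble

end MED

theorem mainTheorem3 {H : Type*} [NormedAddCommGroup H] [InnerProductSpace ℂ H] [CompleteSpace H]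
    [FiniteDimensional ℂ H] {m : ℕ} (r : Fin m → ℕ) (p : Fin m → ℝ) (ρ : Fin m → H →L[ℂ] H)
    (hP : MED.IsLIEnsemble r p ρ) (E : Fin m → H →L[ℂ] H) (hE : MED.IsOptimalPOVM p ρ E)
    (ψ : MED.Idx r → H) (hψ : MED.IsDecomposition p ρ ψ) :
    (∃! W, MED.IsAdapted ψ E W) ∧
    ∀ W, MED.IsAdapted ψ E W →
      (∀ i, (MED.X ψ W i).PosDef) ∧
      MED.IsLIEnsemble r (MED.q ψ W) (MED.sigma ψ W) ∧
      (∀ i, MED.supp ((MED.q ψ W i : ℂ) • MED.sigma ψ W i) = MED.supp ((p i : ℂ) • ρ i)) ∧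
      (∀ i, E i = MED.pgm (MED.q ψ W) (MED.sigma ψ W) i) := by
  open MED in
  have hli := hψ.linearIndependent hP
  have hsp := hψ.span_eq_top hP
  have hPOVM := hE.1
  have hopt := lagrange_optimality (R := fun i => (p i : ℂ) • ρ i) hP.smul_isPositive hPOVM
    fun F hF => by simpa only [successProb_eq] using hE.2 F hF
  set Z := lagrange (fun i => (p i : ℂ) • ρ i) E
  simp only [hψ _] at hopt
  obtain ⟨hZR, hZE⟩ := hopt
  have hZ : Z.IsPositive := by
    obtain ⟨i⟩ := hP.nonempty
    simpa using (hZR i).add (isPositive_sum_ketbra fun k => ψ ⟨i, k⟩)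
  have hinj := injective_of_forall_sub_isPositive hsp hZR
  have hu : IsUnit Z := ContinuousLinearMap.isUnit_iff_bijective.2
    ⟨hinj, LinearMap.surjective_of_injective (f := (Z : H →ₗ[ℂ] H)) hinj⟩
  refine ⟨?_, fun W hW => ?_⟩
  · obtain ⟨W, hW⟩ := exists_adapted hli hsp hPOVM hZ.isSelfAdjoint hu hZE
    exact ⟨W, hW, fun W' hW' => adapted_unique hli hinj hZE hW' hW⟩
  have hsum : ∑ b, ketbra (measVec ψ W b) = 1 := by
    rw [Fintype.sum_sigma, ← hPOVM.sum_eq]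
    exact Finset.sum_congr rfl fun i _ => (hW.resolves i).symm
  -- There are exactly `dim H` vectors resolving the identity, since the ranks add up to the
  -- dimension.
  have hw := (orthonormal_of_sum_ketbra_eq_one (card_Idx hP) hsum).linearIndependent
  have hχ : ∀ i, LinearIndependent ℂ (chi ψ W i) := by
    intro i
    have h := (hw.map' (Z : H →ₗ[ℂ] H) (LinearMap.ker_eq_bot.2 hinj)).comp
      (fun j : Fin (r i) => (⟨i, j⟩ : Idx r)) fun j k hjk => by simpa using hjk
    have he : chi ψ W i = (Z ∘ measVec ψ W) ∘ fun j : Fin (r i) => (⟨i, j⟩ : Idx r) :=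
      funext fun j => (apply_measVec hli hZE hW i j).symm
    rw [he]
    exact h
  have hwt : ∀ i, 0 < weight ψ W i := fun i => weight_pos (hP.rank_pos i) (hχ i)
  have hsupp : ∀ i, supp (sigma ψ W i) = supp (ρ i) := by
    intro i
    have : ((weight ψ W i : ℂ))⁻¹ ≠ 0 := inv_ne_zero (by exact_mod_cast (hwt i).ne')
    rw [sigma, supp_smul this, supp_sum_ketbra, span_chi hli i (hχ i), hψ.supp_eq hP]
  have hens := isLIEnsemble_q_sigma hP hwt hsupp
  refine ⟨fun i => posDef_X hW.posSemidef i (hχ i), hens,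
    fun i => by rw [hens.supp_smul, hP.supp_smul, hsupp], ?_⟩
  have := hP.nonempty
  refine eq_pgm_of_smul_eq hPOVM.sum_eq hZ hu
    (Finset.sum_pos (fun l _ => hwt l) Finset.univ_nonempty) fun i => ?_
  rw [q_smul_sigma (hwt i).ne', hW.resolves i, mul_sum_ketbra_mul hZ.isSelfAdjoint]
  simp_rw [apply_measVec hli hZE hW]
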